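/- Let $n\in\mathbb{N}$ and let $\mathcal{K}^n$ be the set of convex bodies in $\mathbb{R}^n$, i.e. of nonempty, compact, convex subsets of $\mathbb{R}^n$; let $B$ be the closed Euclidean unit ball and $m$ a real number with $m>n-1$. Let $V:\mathcal{K}^n\to\mathbb{R}$ be a map such that - $V$ is a valuation: $V(K\cup L)+V(K\cap L)=V(K)+V(L)$ for all $K,L\in\mathcal{K}^n$ with $K\cup L\in\mathcal{K}^n$; - $V$ is translation invariant: $V(K+x)=V(K)$ for all $K\in\mathcal{K}^n$ and $x\in\mathbb{R}^n$; - $V$ is $m$-homogeneous: $V(\lambda K)=\lambda^m V(K)$ for all $\lambda\ge 0$ and $K\in\mathcal{K}^n$; - $V$ is bounded on $\mathcal{K}(B)=\{K\in\mathcal{K}^n: K\subset B\}$, i.e. $\sup_{K\in\mathcal{K}(B)}|V(K)|<\infty$. If there is a basis $\{e_i\}_{i=1}^n$ of $\mathbb{R}^n$ such that $V(P)=0$ for every parallelotope $P=\sum_{i=1}^n[a_i,b_i]e_i$ with real numbers $a_i\le b_i$ $(1\le i\le n)$, then $V(K)=0$ for every $K\in\mathcal{K}^n$. -/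

import Mathlib

open scoped Pointwise

namespace ConvVal

/-- Euclidean space of dimension `n`. -/
abbrev Euc (n : ℕ) : Type := EuclideanSpace ℝ (Fin n)

/-- The translate `K + x` of a convex body. -/
def translate {n : ℕ} (K : ConvexBody (Euc n)) (x : Euc n) : ConvexBody (Euc n) where
  carrier := (fun y => y + x) '' (K : Set (Euc n))
  convex' := by
    simpa only [Set.add_singleton] using K.convex.add (convex_singleton x)
  isCompact' := K.isCompact.image (by fun_prop)
  nonempty' := K.nonempty.image _

/-- `V` is a valuation on convex bodies: `V (K ∪ L) + V (K ∩ L) = V K + V L` whenever `K ∪ L` is a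
convex body. Here `U` is the body `K ∪ L` and `I` is the body `K ∩ L`; when `K ∪ L` is convex,
the intersection is automatically nonempty (see `exists_inter`), so `I` always exists. -/
def IsValuation {n : ℕ} (V : ConvexBody (Euc n) → ℝ) : Prop :=
  ∀ K L U I : ConvexBody (Euc n),
    (U : Set (Euc n)) = (K : Set (Euc n)) ∪ L →
    (I : Set (Euc n)) = (K : Set (Euc n)) ∩ L →
    V U + V I = V K + V L

/-- If the union of two convex bodies is a convex body, so is their intersection. -/
theorem exists_inter {n : ℕ} (K L U : ConvexBody (Euc n))
    (h : (U : Set (Euc n)) = (K : Set (Euc n)) ∪ L) :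
    ∃ I : ConvexBody (Euc n), (I : Set (Euc n)) = (K : Set (Euc n)) ∩ L := by
  have hc : IsPreconnected (U : Set (Euc n)) := U.convex.isPreconnected
  have hne : ((K : Set (Euc n)) ∩ L).Nonempty := by
    have h1 := isPreconnected_closed_iff.1 hc _ _ K.isClosed L.isClosed h.le
      (by rw [h, Set.union_inter_cancel_left]; exact K.nonempty)
      (by rw [h, Set.union_inter_cancel_right]; exact L.nonempty)
    exact h1.mono Set.inter_subset_right
  exact ⟨⟨(K : Set (Euc n)) ∩ L, K.convex.inter L.convex, K.isCompact.inter L.isCompact, hne⟩, rfl⟩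

/-- `V (K + x) = V K` for all convex bodies `K` and all vectors `x`. -/
def IsTranslationInvariant {n : ℕ} (V : ConvexBody (Euc n) → ℝ) : Prop :=
  ∀ (K : ConvexBody (Euc n)) (x : Euc n), V (translate K x) = V K

/-- `V (r K) = r ^ m * V K` for all real `r ≥ 0` and all convex bodies `K`
(the degree `m` is a real number). -/
def IsHomogeneous {n : ℕ} (m : ℝ) (V : ConvexBody (Euc n) → ℝ) : Prop :=
  ∀ (r : ℝ), 0 ≤ r → ∀ K : ConvexBody (Euc n), V (r • K) = r ^ m * V K

/-- `V` is bounded on the convex bodies contained in the closed Euclidean unit ball. -/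
def IsBoundedOnUnitBall {n : ℕ} (V : ConvexBody (Euc n) → ℝ) : Prop :=
  ∃ C : ℝ, ∀ K : ConvexBody (Euc n), (K : Set (Euc n)) ⊆ Metric.closedBall 0 1 → |V K| ≤ C

/-- The class of the parallelotopes `∑ i, [a i, c i] e i`, with `a i ≤ c i` for all `i`, that are
associated with a basis `e`. -/
def parallelotopes {n : ℕ} (e : Module.Basis (Fin n) ℝ (Euc n)) : Set (ConvexBody (Euc n)) :=
  {K | ∃ a c : Fin n → ℝ, (∀ i, a i ≤ c i) ∧
    (K : Set (Euc n)) = ∑ i, (fun t : ℝ => t • e i) '' Set.Icc (a i) (c i)}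

end ConvVal

/-!
The proof compares two rates of growth. Tile space by the unit cells of the lattice generated by
the basis `e`, and let `N` be a large integer. Inclusion-exclusion along the lattice hyperplanes
(`ConvVal.extend_eq_sum_cell`) writes `V (N K)` as a signed sum of the values of `V` on the
intersections of `N K` with the cells, cells of all dimensions included. A cell that misses `N K`
contributes nothing, and a cell inside `N K` contributes nothing either, since it is a (possibly
degenerate) parallelotope on which `V` vanishes. Each of the remaining boundary cells contributes
at most a constant, by translation invariance and boundedness
(`ConvVal.exists_bound_cell`).

There are only `O(N ^ (n - 1))` boundary cells (`ConvVal.card_boundary_le`): if a cell contains a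
point `y` outside the convex set, separate `y` by a functional `f` and let `e i` maximize
`|f (e i)|`; moving the cell by `n` or more steps along `± e i` then takes it off the convex set, so
every line of cells parallel to `e i` has at most `n` boundary cells of this kind for either sign.

Hence `N ^ m * |V K| = |V (N K)| = O(N ^ (n - 1))`, and `m > n - 1` forces `V K = 0`.
-/

/-! ### Valuations on possibly empty compact convex sets -/

namespace ConvVal

open Finset

variable {n : ℕ}

/-- The extension of `V` to arbitrary sets by `0`; in particular it vanishes on `∅`. -/
noncomputable def extend (V : ConvexBody (Euc n) → ℝ) (A : Set (Euc n)) : ℝ :=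
  open Classical in if h : ∃ K : ConvexBody (Euc n), (K : Set (Euc n)) = A then V h.choose else 0

theorem extend_coe (V : ConvexBody (Euc n) → ℝ) (K : ConvexBody (Euc n)) :
    extend V K = V K := by
  have h : ∃ L : ConvexBody (Euc n), (L : Set (Euc n)) = K := ⟨K, rfl⟩
  rw [extend, dif_pos h]
  exact congrArg V (SetLike.coe_injective h.choose_spec)

theorem extend_empty (V : ConvexBody (Euc n) → ℝ) : extend V ∅ = 0 := by
  rw [extend, dif_neg]
  rintro ⟨K, hK⟩
  exact K.nonempty.ne_empty hK

theorem exists_coe_eq {A : Set (Euc n)} (hA : Convex ℝ A) (hA' : IsCompact A)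
    (hne : A.Nonempty) : ∃ K : ConvexBody (Euc n), (K : Set (Euc n)) = A :=
  ⟨⟨A, hA, hA', hne⟩, rfl⟩

/-- The valuation property for a compact convex set cut by a level set of a linear functional;
the parts may be empty. -/
theorem extend_cut {V : ConvexBody (Euc n) → ℝ} (hval : IsValuation V)
    (f : Euc n →ₗ[ℝ] ℝ) {A : Set (Euc n)} (hA : Convex ℝ A) (hA' : IsCompact A) (t : ℝ) :
    extend V A + extend V (A ∩ f ⁻¹' {t}) =
      extend V (A ∩ f ⁻¹' Set.Iic t) + extend V (A ∩ f ⁻¹' Set.Ici t) := by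
  have hf : Continuous f := f.continuous_of_finiteDimensional
  have hI : A ∩ f ⁻¹' {t} = (A ∩ f ⁻¹' Set.Iic t) ∩ (A ∩ f ⁻¹' Set.Ici t) := by
    ext x
    simp only [Set.mem_inter_iff, Set.mem_preimage, Set.mem_singleton_iff, Set.mem_Iic, Set.mem_Ici,
      le_antisymm_iff]
    tauto
  have hU : A = (A ∩ f ⁻¹' Set.Iic t) ∪ (A ∩ f ⁻¹' Set.Ici t) := by
    rw [← Set.inter_union_distrib_left, ← Set.preimage_union, Set.Iic_union_Ici,
      Set.preimage_univ, Set.inter_univ]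
  rw [hI]
  rcases Set.eq_empty_or_nonempty (A ∩ f ⁻¹' Set.Iic t) with h1 | h1
  · rw [h1, Set.empty_union] at hU
    rw [← hU, h1, Set.empty_inter, add_comm]
  rcases Set.eq_empty_or_nonempty (A ∩ f ⁻¹' Set.Ici t) with h2 | h2
  · rw [h2, Set.union_empty] at hU
    rw [← hU, h2, Set.inter_empty]
  obtain ⟨K, hK⟩ := exists_coe_eq (hA.inter ((convex_Iic t).linear_preimage f))
    (hA'.inter_right (isClosed_Iic.preimage hf)) h1
  obtain ⟨L, hL⟩ := exists_coe_eq (hA.inter ((convex_Ici t).linear_preimage f))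
    (hA'.inter_right (isClosed_Ici.preimage hf)) h2
  obtain ⟨U, hKL⟩ := exists_coe_eq hA hA' (h1.mono Set.inter_subset_left)
  have hKLU : (U : Set (Euc n)) = (K : Set (Euc n)) ∪ L := by rw [hK, hL, hKL, ← hU]
  obtain ⟨I, hKLI⟩ := exists_inter K L U hKLU
  rw [← hK, ← hL, ← hKLI, ← hKL]
  simpa only [extend_coe] using hval K L U I hKLU hKLI

/-! ### Signed unit cells -/

/-- The interval coded by `p`: `[p.1, p.1 + 1]` if `p.2` is `true`, the point `p.1` otherwise. -/
def interval (p : ℕ × Bool) : Set ℝ := Set.Icc (p.1 : ℝ) (p.1 + cond p.2 1 0)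

/-- The sign with which `interval p` enters the decomposition of a segment: closed unit intervals
count `+1`, their left endpoints `-1`. -/
def sgn (p : ℕ × Bool) : ℝ := cond p.2 1 (-1)

/-- The cell coded by `c`, restricted in the coordinates (with respect to the basis `e`) that
belong to `s` only. -/
def cell (e : Module.Basis (Fin n) ℝ (Euc n)) (s : Finset (Fin n)) (c : Fin n → ℕ × Bool) :
    Set (Euc n) :=
  {x | ∀ i ∈ s, e.coord i x ∈ interval (c i)}

theorem interval_subset (p : ℕ × Bool) : interval p ⊆ Set.Icc (p.1 : ℝ) (p.1 + 1) :=
  Set.Icc_subset_Icc_right (by cases p.2 <;> simp)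

theorem convex_cell (e : Module.Basis (Fin n) ℝ (Euc n)) (s : Finset (Fin n))
    (c : Fin n → ℕ × Bool) : Convex ℝ (cell e s c) := by
  have : cell e s c = ⋂ i ∈ s, e.coord i ⁻¹' interval (c i) := by
    ext x; simp [cell]
  rw [this]
  exact convex_iInter₂ fun i _ => (convex_Icc _ _).linear_preimage _

theorem isClosed_cell (e : Module.Basis (Fin n) ℝ (Euc n)) (s : Finset (Fin n))
    (c : Fin n → ℕ × Bool) : IsClosed (cell e s c) := by
  have : cell e s c = ⋂ i ∈ s, e.coord i ⁻¹' interval (c i) := by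
    ext x; simp [cell]
  rw [this]
  exact isClosed_biInter fun i _ =>
    isClosed_Icc.preimage (e.coord i).continuous_of_finiteDimensional

theorem cell_insert (e : Module.Basis (Fin n) ℝ (Euc n)) {s : Finset (Fin n)} {j : Fin n}
    (hj : j ∉ s) (c : Fin n → ℕ × Bool) (p : ℕ × Bool) :
    cell e (insert j s) (Function.update c j p) = cell e s c ∩ e.coord j ⁻¹' interval p := by
  ext x
  simp only [cell, Set.mem_ofPred_eq, Set.mem_inter_iff, Set.mem_preimage, forall_mem_insert,
    Function.update_self]
  rw [and_comm]
  refine and_congr_left fun _ => forall₂_congr fun i hi => ?_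
  rw [Function.update_of_ne (ne_of_mem_of_not_mem hi hj)]

/-- Cutting a compact convex set along the integer levels of one functional `f`. The sum
telescopes, and its lower end vanishes since `f` is positive on `A`. -/
theorem extend_eq_sum_interval {V : ConvexBody (Euc n) → ℝ} (hval : IsValuation V)
    (f : Euc n →ₗ[ℝ] ℝ) {A : Set (Euc n)} (hA : Convex ℝ A) (hA' : IsCompact A) {M : ℕ}
    (hf : ∀ x ∈ A, f x ∈ Set.Ioo (0 : ℝ) M) :
    extend V A = ∑ p ∈ range M ×ˢ univ, sgn p * extend V (A ∩ f ⁻¹' interval p) := by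
  have hfc : Continuous f := f.continuous_of_finiteDimensional
  have hstep (k : ℕ) : extend V (A ∩ f ⁻¹' Set.Iic ((k + 1 : ℕ) : ℝ)) -
      extend V (A ∩ f ⁻¹' Set.Iic (k : ℝ)) =
      ∑ b : Bool, sgn (k, b) * extend V (A ∩ f ⁻¹' interval (k, b)) := by
    have h := extend_cut hval f (hA.inter ((convex_Iic ((k + 1 : ℕ) : ℝ)).linear_preimage f))
      (hA'.inter_right (isClosed_Iic.preimage hfc)) k
    have h1 : Set.Iic ((k + 1 : ℕ) : ℝ) ∩ {(k : ℝ)} = Set.Icc (k : ℝ) k := by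
      rw [Set.Icc_self, Set.inter_eq_right]; simp
    have h2 : Set.Iic ((k + 1 : ℕ) : ℝ) ∩ Set.Iic (k : ℝ) = Set.Iic (k : ℝ) := by
      rw [Set.inter_eq_right]; exact Set.Iic_subset_Iic.2 (by simp)
    have h3 : Set.Iic ((k + 1 : ℕ) : ℝ) ∩ Set.Ici (k : ℝ) = Set.Icc (k : ℝ) (k + 1) := by
      rw [Set.Iic_inter_Ici, Nat.cast_succ]
    rw [Set.inter_assoc, Set.inter_assoc, Set.inter_assoc, ← Set.preimage_inter,
      ← Set.preimage_inter, ← Set.preimage_inter, h1, h2, h3] at h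
    simp only [Fintype.sum_bool, sgn, interval, cond_true, cond_false, add_zero]
    linarith
  have h0 : A ∩ f ⁻¹' Set.Iic ((0 : ℕ) : ℝ) = ∅ := by
    ext x
    simp only [Set.mem_inter_iff, Set.mem_preimage, Set.mem_Iic, Set.mem_empty_iff_false,
      iff_false, not_and, not_le, Nat.cast_zero]
    exact fun hx => (hf x hx).1
  have hM : A ∩ f ⁻¹' Set.Iic (M : ℝ) = A :=
    Set.inter_eq_left.2 fun x hx => (hf x hx).2.le
  rw [sum_product, ← sum_congr rfl fun k _ => hstep k,
    sum_range_sub (fun k : ℕ => extend V (A ∩ f ⁻¹' Set.Iic (k : ℝ))), h0, hM, extend_empty,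
    sub_zero]

theorem sum_piFinset_insert {ι β : Type*} [Fintype ι] [DecidableEq ι]
    {s : Finset ι} {j : ι} (hj : j ∉ s) (t : Finset β) (b : β) (G : (ι → β) → ℝ) :
    ∑ c ∈ Fintype.piFinset (fun i => if i ∈ insert j s then t else {b}), G c =
      ∑ c ∈ Fintype.piFinset (fun i => if i ∈ s then t else {b}),
        ∑ p ∈ t, G (Function.update c j p) := by
  rw [← sum_product']
  refine sum_nbij' (fun c => (Function.update c j b, c j)) (fun q => Function.update q.1 j q.2)
    ?_ ?_ ?_ ?_ ?_
  · intro c hc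
    simp only [Fintype.mem_piFinset, mem_product] at hc ⊢
    refine ⟨fun i => ?_, by simpa using hc j⟩
    rcases eq_or_ne i j with rfl | hij
    · simp [hj]
    · simpa [hij] using hc i
  · rintro ⟨c, p⟩ hc
    simp only [Fintype.mem_piFinset, mem_product] at hc ⊢
    intro i
    rcases eq_or_ne i j with rfl | hij
    · simpa using hc.2
    · simpa [hij] using hc.1 i
  · intro c _
    simp
  · rintro ⟨c, p⟩ hc
    simp only [Fintype.mem_piFinset, mem_product] at hc
    have : c j = b := by simpa [hj] using hc.1 j
    simp [← this]
  · intro c _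
    simp

/-- The codes of the cells that tile the cube `[0, M]ⁿ`. -/
def codes (n M : ℕ) : Finset (Fin n → ℕ × Bool) :=
  Fintype.piFinset fun _ => range M ×ˢ univ

/-- Inclusion-exclusion for the tiling of `[0, M]ⁿ` by unit cells. Cells of all dimensions occur,
so `V` need not vanish on lower-dimensional bodies. -/
theorem extend_eq_sum_cell {V : ConvexBody (Euc n) → ℝ} (hval : IsValuation V)
    (e : Module.Basis (Fin n) ℝ (Euc n)) {A : Set (Euc n)} (hA : Convex ℝ A) (hA' : IsCompact A)
    {M : ℕ} (hM : ∀ x ∈ A, ∀ i, e.coord i x ∈ Set.Ioo (0 : ℝ) M) :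
    extend V A = ∑ c ∈ codes n M, (∏ i, sgn (c i)) * extend V (A ∩ cell e univ c) := by
  -- The induction adds one coordinate at a time; coordinates outside `s` carry a dummy code.
  suffices H : ∀ s : Finset (Fin n), extend V A =
      ∑ c ∈ Fintype.piFinset (fun i => if i ∈ s then range M ×ˢ univ else {((0 : ℕ), true)}),
        (∏ i ∈ s, sgn (c i)) * extend V (A ∩ cell e s c) by
    simpa [codes] using H univ
  intro s
  induction s using Finset.induction_on with
  | empty => simp [cell, Fintype.piFinset_singleton]
  | insert j s hj ih =>
    rw [sum_piFinset_insert hj, ih]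
    refine sum_congr rfl fun c _ => ?_
    rw [extend_eq_sum_interval hval (e.coord j) (hA.inter (convex_cell e s c))
      (hA'.inter_right (isClosed_cell e s c)) fun x hx => hM x hx.1 j, mul_sum]
    refine sum_congr rfl fun p _ => ?_
    have hprod : ∏ i ∈ s, sgn (Function.update c j p i) = ∏ i ∈ s, sgn (c i) :=
      prod_congr rfl fun i hi => by rw [Function.update_of_ne (ne_of_mem_of_not_mem hi hj)]
    rw [prod_insert hj, cell_insert e hj, Function.update_self, Set.inter_assoc, hprod]
    ring

/-! ### Counting boundary cells -/

/-- The codes of cells that meet `A` but cease to do so when moved by `n` or more steps in the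
direction `σ • e i`. -/
def IsLast (e : Module.Basis (Fin n) ℝ (Euc n)) (A : Set (Euc n)) (i : Fin n) (σ : ℤ)
    (c : Fin n → ℕ × Bool) : Prop :=
  (A ∩ cell e univ c).Nonempty ∧ ∀ c' : Fin n → ℕ × Bool, (∀ j ≠ i, c' j = c j) →
    (n : ℤ) ≤ σ * ((c' i).1 - (c i).1) → ¬ (A ∩ cell e univ c').Nonempty

/-- A cell that meets `A` without lying in `A` is last in some coordinate direction: separate a
point of the cell from `A` by a functional, and move in the direction in which this functional
grows fastest. -/
theorem exists_isLast (e : Module.Basis (Fin n) ℝ (Euc n)) {A : Set (Euc n)} (hA : Convex ℝ A)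
    (hA' : IsCompact A) {c : Fin n → ℕ × Bool} (h : (A ∩ cell e univ c).Nonempty)
    (h' : ¬ cell e univ c ⊆ A) : ∃ i, ∃ σ ∈ ({1, -1} : Finset ℤ), IsLast e A i σ c := by
  obtain ⟨y, hy, hyA⟩ := Set.not_subset.1 h'
  obtain ⟨f, u, hfA, hfy⟩ := geometric_hahn_banach_closed_point hA hA'.isClosed hyA
  have hne : Nonempty (Fin n) := by
    by_contra hn
    rw [not_nonempty_iff] at hn
    obtain ⟨x, hx, -⟩ := h
    have : x = y := e.repr.injective (Subsingleton.elim _ _)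
    exact hyA (this ▸ hx)
  obtain ⟨i, -, hi⟩ := exists_max_image univ (fun i => |f (e i)|) univ_nonempty
  obtain ⟨σ, hσ, hσ', hσf⟩ : ∃ σ ∈ ({1, -1} : Finset ℤ), (σ : ℝ) * σ = 1 ∧
      (σ : ℝ) * f (e i) = |f (e i)| := by
    rcases le_total 0 (f (e i)) with h0 | h0
    · exact ⟨1, by simp, by simp, by simp [abs_of_nonneg h0]⟩
    · exact ⟨-1, by simp, by simp, by simp [abs_of_nonpos h0]⟩
  refine ⟨i, σ, hσ, h, fun c' hc' hk => ?_⟩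
  rintro ⟨p, hpA, hp⟩
  have hbound (j : Fin n) (hj : j ∈ univ.erase i) :
      -|f (e i)| ≤ (e.coord j p - e.coord j y) * f (e j) := by
    have h1 := interval_subset _ (hp j (mem_univ j))
    have h2 := interval_subset _ (hy j (mem_univ j))
    rw [hc' j (ne_of_mem_erase hj)] at h1
    have h3 : |e.coord j p - e.coord j y| ≤ 1 :=
      abs_le.2 ⟨by linarith [h1.1, h2.2], by linarith [h1.2, h2.1]⟩
    have h4 := mul_le_mul h3 (hi j (mem_univ j)) (abs_nonneg _) zero_le_one
    rw [← abs_mul, one_mul] at h4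
    exact (abs_le.1 h4).1
  have hmain : ((n : ℝ) - 1) * |f (e i)| ≤ (e.coord i p - e.coord i y) * f (e i) := by
    have h1 := interval_subset _ (hp i (mem_univ i))
    have h2 := interval_subset _ (hy i (mem_univ i))
    have h3 : (n : ℝ) ≤ σ * ((c' i).1 - (c i).1) := by exact_mod_cast hk
    have h4 : (n : ℝ) - 1 ≤ σ * (e.coord i p - e.coord i y) := by
      rcases mem_insert.1 hσ with rfl | hσ1
      · push_cast at h3 ⊢; linarith [h1.1, h2.2]
      · rw [mem_singleton.1 hσ1] at h3 ⊢
        push_cast at h3 ⊢; linarith [h1.2, h2.1]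
    calc ((n : ℝ) - 1) * |f (e i)|
        ≤ (σ * (e.coord i p - e.coord i y)) * |f (e i)| :=
          mul_le_mul_of_nonneg_right h4 (abs_nonneg _)
      _ = (σ * σ) * ((e.coord i p - e.coord i y) * f (e i)) := by rw [← hσf]; ring
      _ = _ := by rw [hσ', one_mul]
  have hsum : f p - f y = ∑ j, (e.coord j p - e.coord j y) * f (e j) := by
    rw [← map_sub, ← e.sum_repr (p - y), map_sum]
    refine sum_congr rfl fun j _ => ?_
    simp
  have hrest := sum_le_sum hbound
  rw [sum_const, card_erase_of_mem (mem_univ i), card_univ, Fintype.card_fin, nsmul_eq_mul,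
    Nat.cast_pred (Fin.pos i)] at hrest
  rw [← add_sum_erase _ _ (mem_univ i)] at hsum
  linarith [hfA p hpA]

open Classical in
/-- Two cells that are last in the same direction and lie on one line differ by less than `n`
steps, so that they are told apart by their positions modulo `n`. -/
theorem card_isLast_le (e : Module.Basis (Fin n) ℝ (Euc n)) (A : Set (Euc n)) (i : Fin n)
    {σ : ℤ} (hσ : σ ∈ ({1, -1} : Finset ℤ)) (M : ℕ) :
    #{c ∈ codes n M | IsLast e A i σ c} ≤ 2 * n * (2 * M) ^ (n - 1) := by
  have hn : 0 < n := Fin.pos i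
  have hcard : #(Fintype.piFinset (Function.update
      (fun _ : Fin n => range M ×ˢ (univ : Finset Bool)) i (range n ×ˢ univ))) =
      2 * n * (2 * M) ^ (n - 1) := by
    rw [Fintype.card_piFinset, ← mul_prod_erase _ _ (mem_univ i), Function.update_self,
      prod_congr rfl fun j hj => by rw [Function.update_of_ne (ne_of_mem_erase hj)]]
    simp only [card_product, card_range, card_univ, Fintype.card_bool, prod_const,
      card_erase_of_mem (mem_univ i), Fintype.card_fin]
    ring
  rw [← hcard]
  refine card_le_card_of_injOn (fun c => Function.update c i ((c i).1 % n, (c i).2)) ?_ ?_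
  · intro c hc
    simp only [coe_filter, Set.mem_ofPred_eq, codes, Fintype.mem_piFinset] at hc
    simp only [mem_coe, Fintype.mem_piFinset]
    intro j
    rcases eq_or_ne j i with rfl | hj
    · simp [Nat.mod_lt _ hn]
    · simpa [hj] using hc.1 j
  · intro c hc d hd hcd
    simp only [coe_filter, Set.mem_ofPred_eq] at hc hd
    have hne (j : Fin n) (hj : j ≠ i) : c j = d j := by
      simpa [hj] using congrFun hcd j
    have hi : (c i).1 % n = (d i).1 % n ∧ (c i).2 = (d i).2 := by
      simpa using congrFun hcd i
    have hfst : (c i).1 = (d i).1 := by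
      by_contra hcdi
      have h1 : (n : ℤ) ∣ (d i).1 - (c i).1 := Nat.ModEq.dvd hi.1
      have h2 : (n : ℤ) ≤ |((d i).1 : ℤ) - (c i).1| :=
        Int.le_of_dvd (abs_pos.2 (by omega)) ((dvd_abs _ _).2 h1)
      have h3 : (n : ℤ) ≤ σ * ((d i).1 - (c i).1) ∨ (n : ℤ) ≤ σ * ((c i).1 - (d i).1) := by
        rcases mem_insert.1 hσ with rfl | hσ1
        · rcases le_abs.1 h2 with h | h
          · left; linarith
          · right; linarith
        · rw [mem_singleton.1 hσ1]
          rcases le_abs.1 h2 with h | h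
          · right; linarith
          · left; linarith
      rcases h3 with h3 | h3
      · exact hc.2.2 d (fun j hj => (hne j hj).symm) h3 hd.2.1
      · exact hd.2.2 c hne h3 hc.2.1
    funext j
    rcases eq_or_ne j i with rfl | hj
    · exact Prod.ext hfst hi.2
    · exact hne j hj

open Classical in
/-- A convex body in `[0, M]ⁿ` has `O(M ^ (n - 1))` boundary cells. -/
theorem card_boundary_le (e : Module.Basis (Fin n) ℝ (Euc n)) {A : Set (Euc n)}
    (hA : Convex ℝ A) (hA' : IsCompact A) (M : ℕ) :
    #{c ∈ codes n M | (A ∩ cell e univ c).Nonempty ∧ ¬ cell e univ c ⊆ A} ≤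
      n * (2 * (2 * n * (2 * M) ^ (n - 1))) := by
  have hsub : {c ∈ codes n M | (A ∩ cell e univ c).Nonempty ∧ ¬ cell e univ c ⊆ A} ⊆
      univ.biUnion fun i => ({1, -1} : Finset ℤ).biUnion fun σ =>
        {c ∈ codes n M | IsLast e A i σ c} := by
    intro c hc
    obtain ⟨hc, h, h'⟩ := mem_filter.1 hc
    obtain ⟨i, σ, hσ, hlast⟩ := exists_isLast e hA hA' h h'
    exact mem_biUnion.2 ⟨i, mem_univ i, mem_biUnion.2 ⟨σ, hσ, mem_filter.2 ⟨hc, hlast⟩⟩⟩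
  refine (card_le_card hsub).trans ?_
  refine (card_biUnion_le_card_mul _ _ (2 * (2 * n * (2 * M) ^ (n - 1))) fun i _ =>
    card_biUnion_le_card_mul _ _ _ fun σ hσ => card_isLast_le e A i hσ M).trans ?_
  rw [card_univ, Fintype.card_fin]

/-! ### The contribution of a single cell -/

theorem cell_nonempty (e : Module.Basis (Fin n) ℝ (Euc n)) (c : Fin n → ℕ × Bool) :
    (cell e univ c).Nonempty := by
  refine ⟨∑ j, ((c j).1 : ℝ) • e j, fun i _ => ?_⟩
  rw [e.coord_apply, e.repr_sum_self]
  exact ⟨le_rfl, le_add_of_nonneg_right (by cases (c i).2 <;> simp)⟩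

theorem mem_parallelotopes_of_eq_cell (e : Module.Basis (Fin n) ℝ (Euc n))
    {c : Fin n → ℕ × Bool} {K : ConvexBody (Euc n)} (hK : (K : Set (Euc n)) = cell e univ c) :
    K ∈ parallelotopes e := by
  refine ⟨fun i => (c i).1, fun i => (c i).1 + cond (c i).2 1 0,
    fun i => le_add_of_nonneg_right (by cases (c i).2 <;> simp), ?_⟩
  rw [hK]
  ext x
  rw [Set.mem_fintype_sum]
  constructor
  · intro hx
    exact ⟨fun i => e.coord i x • e i, fun i => ⟨_, hx i (mem_univ i), rfl⟩, e.sum_repr x⟩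
  · rintro ⟨g, hg, rfl⟩ i -
    choose t ht hg using hg
    simp only [← hg]
    rw [e.coord_apply, e.repr_sum_self]
    exact ht i

/-- `V` is bounded on the bodies contained in some unit cell: translate the cell to the origin and
shrink it into the unit ball. -/
theorem exists_bound_cell {m : ℝ} {V : ConvexBody (Euc n) → ℝ}
    (htrans : IsTranslationInvariant V) (hhom : IsHomogeneous m V) (hbdd : IsBoundedOnUnitBall V)
    (e : Module.Basis (Fin n) ℝ (Euc n)) :
    ∃ C : ℝ, 0 ≤ C ∧ ∀ (c : Fin n → ℕ × Bool) (K : ConvexBody (Euc n)),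
      (K : Set (Euc n)) ⊆ cell e univ c → |V K| ≤ C := by
  obtain ⟨C, hC⟩ := hbdd
  set R : ℝ := 1 + ∑ i, ‖e i‖
  have hRpos : 0 < R := by positivity
  have key (c : Fin n → ℕ × Bool) (K : ConvexBody (Euc n))
      (hK : (K : Set (Euc n)) ⊆ cell e univ c) : |V K| ≤ R ^ m * |C| := by
    set v : Euc n := -∑ j, ((c j).1 : ℝ) • e j with hv
    have hsub : ((R⁻¹ • translate K v : ConvexBody (Euc n)) : Set (Euc n)) ⊆
        Metric.closedBall 0 1 := by
      rw [ConvexBody.coe_smul]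
      rintro _ ⟨_, ⟨x, hx, rfl⟩, rfl⟩
      have hnorm : ‖x + v‖ ≤ R := by
        have hxv : x + v = ∑ j, (e.coord j x - (c j).1) • e j := by
          simp only [sub_smul, sum_sub_distrib, e.coord_apply, e.sum_repr, hv]
          exact (sub_eq_add_neg _ _).symm
        rw [hxv]
        refine (norm_sum_le _ _).trans (le_trans (sum_le_sum fun j _ => ?_)
          (le_add_of_nonneg_left zero_le_one))
        have := interval_subset _ (hK hx j (mem_univ j))
        rw [norm_smul, Real.norm_eq_abs, abs_of_nonneg (by linarith [this.1])]
        exact mul_le_of_le_one_left (norm_nonneg _) (by linarith [this.2])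
      simp only [mem_closedBall_zero_iff, norm_smul, norm_inv, Real.norm_eq_abs,
        abs_of_pos hRpos]
      exact inv_mul_le_one_of_le₀ hnorm hRpos.le
    have hRK : V K = R ^ m * V (R⁻¹ • translate K v) := by
      rw [← hhom R hRpos.le, smul_inv_smul₀ hRpos.ne', htrans]
    rw [hRK, abs_mul, abs_of_nonneg (Real.rpow_nonneg hRpos.le m)]
    exact mul_le_mul_of_nonneg_left ((hC _ hsub).trans (le_abs_self C))
      (Real.rpow_nonneg hRpos.le m)
  exact ⟨R ^ m * |C|, by positivity, key⟩

/-- Only boundary cells contribute to the cell decomposition of `V K`. -/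
theorem exists_abs_le_card_boundary {m : ℝ} {V : ConvexBody (Euc n) → ℝ} (hval : IsValuation V)
    (htrans : IsTranslationInvariant V) (hhom : IsHomogeneous m V) (hbdd : IsBoundedOnUnitBall V)
    (e : Module.Basis (Fin n) ℝ (Euc n)) (hpar : ∀ K ∈ parallelotopes e, V K = 0) :
    ∃ C : ℝ, 0 ≤ C ∧ ∀ (K : ConvexBody (Euc n)) (M : ℕ),
      (∀ x ∈ K, ∀ i, e.coord i x ∈ Set.Ioo (0 : ℝ) M) →
        |V K| ≤ (n * (2 * (2 * n * (2 * M) ^ (n - 1)))) * C := by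
  classical
  obtain ⟨C, hC0, hC⟩ := exists_bound_cell htrans hhom hbdd e
  refine ⟨C, hC0, fun K M hM => ?_⟩
  set S := {c ∈ codes n M | ((K : Set (Euc n)) ∩ cell e univ c).Nonempty ∧
    ¬ cell e univ c ⊆ K} with hS
  have hcell (c : Fin n → ℕ × Bool) :
      |(∏ i, sgn (c i)) * extend V (K ∩ cell e univ c)| ≤ C ∧
      ((((K : Set (Euc n)) ∩ cell e univ c).Nonempty ∧ ¬ cell e univ c ⊆ K) ∨
        (∏ i, sgn (c i)) * extend V (K ∩ cell e univ c) = 0) := by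
    have hsgn : |∏ i, sgn (c i)| = 1 := by
      rw [abs_prod]
      exact prod_eq_one fun i _ => by unfold sgn; cases (c i).2 <;> simp
    rcases Set.eq_empty_or_nonempty ((K : Set (Euc n)) ∩ cell e univ c) with h | h
    · simp [h, extend_empty, hC0]
    obtain ⟨L, hL⟩ := exists_coe_eq (K.convex.inter (convex_cell e univ c))
      (K.isCompact.inter_right (isClosed_cell e univ c)) h
    rw [abs_mul, hsgn, one_mul, ← hL, extend_coe]
    refine ⟨hC c L (hL ▸ Set.inter_subset_right), ?_⟩
    by_cases h' : cell e univ c ⊆ K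
    · right
      rw [hpar L (mem_parallelotopes_of_eq_cell e (hL.trans (Set.inter_eq_right.2 h'))), mul_zero]
    · exact Or.inl ⟨hL ▸ h, h'⟩
  calc |V K| = |∑ c ∈ codes n M, (∏ i, sgn (c i)) * extend V (K ∩ cell e univ c)| := by
        rw [← extend_eq_sum_cell hval e K.convex K.isCompact hM, extend_coe]
    _ = |∑ c ∈ S, (∏ i, sgn (c i)) * extend V (K ∩ cell e univ c)| := by
        rw [hS, sum_filter_of_ne fun c _ hc => (hcell c).2.resolve_right hc]
    _ ≤ ∑ c ∈ S, |(∏ i, sgn (c i)) * extend V (K ∩ cell e univ c)| := abs_sum_le_sum_abs _ _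
    _ ≤ #S * C := by
        rw [← nsmul_eq_mul]
        exact sum_le_card_nsmul _ _ _ fun c _ => (hcell c).1
    _ ≤ _ := by
        refine mul_le_mul_of_nonneg_right ?_ hC0
        exact_mod_cast card_boundary_le e K.convex K.isCompact M

theorem exists_translate_coord_mem_Ioo (e : Module.Basis (Fin n) ℝ (Euc n))
    (K : ConvexBody (Euc n)) : ∃ (v : Euc n) (M : ℕ),
      ∀ x ∈ translate K v, ∀ i, e.coord i x ∈ Set.Ioo (0 : ℝ) M := by
  have hb (i : Fin n) : ∃ b : ℝ, ∀ x ∈ K, |e.coord i x| ≤ b := by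
    obtain ⟨b, hb⟩ := K.isCompact.exists_bound_of_continuousOn
      (e.coord i).continuous_of_finiteDimensional.continuousOn
    exact ⟨b, hb⟩
  choose b hb using hb
  obtain ⟨M, hM⟩ := exists_nat_gt (∑ i, |b i|)
  have hlt (i : Fin n) (x : Euc n) (hx : x ∈ K) : |e.coord i x| < M :=
    ((hb i x hx).trans (le_abs_self _)).trans_lt ((single_le_sum (f := fun i => |b i|)
      (fun i _ => abs_nonneg _) (mem_univ i)).trans_lt hM)
  refine ⟨∑ j, (M : ℝ) • e j, 2 * M, ?_⟩
  rintro _ ⟨x, hx, rfl⟩ i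
  have h := abs_lt.1 (hlt i x hx)
  have hv : e.coord i (x + ∑ j, (M : ℝ) • e j) = e.coord i x + M := by
    rw [map_add, e.coord_apply i (∑ j, _), e.repr_sum_self]
  simp only [hv, Nat.cast_mul, Nat.cast_ofNat]
  exact ⟨by linarith [h.1], by linarith [h.2]⟩

end ConvVal

theorem lemmal (n : ℕ) (m : ℝ) (hm : (n : ℝ) - 1 < m)
    (V : ConvexBody (ConvVal.Euc n) → ℝ)
    (hval : ConvVal.IsValuation V)
    (htrans : ConvVal.IsTranslationInvariant V)
    (hhom : ConvVal.IsHomogeneous m V)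
    (hbdd : ConvVal.IsBoundedOnUnitBall V)
    (hpar : ∃ e : Module.Basis (Fin n) ℝ (ConvVal.Euc n), ∀ K ∈ ConvVal.parallelotopes e, V K = 0) :
    ∀ K : ConvexBody (ConvVal.Euc n), V K = 0 := by
  intro K
  obtain ⟨e, hpar⟩ := hpar
  obtain ⟨C, -, hC⟩ := ConvVal.exists_abs_le_card_boundary hval htrans hhom hbdd e hpar
  obtain ⟨v, M, hM⟩ := ConvVal.exists_translate_coord_mem_Ioo e K
  rw [← htrans K v]
  set L := ConvVal.translate K v
  rcases Nat.eq_zero_or_pos n with rfl | hn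
  · -- For `n = 0` there are no boundary cells; `n - 1` is truncated below, so `n > 0` matters there.
    have h := hC L M hM
    simpa using h
  set D : ℝ := (n * (2 * (2 * n * (2 * M) ^ (n - 1)))) * C with hD
  have hbound (N : ℕ) (hN : 0 < N) : |V L| ≤ D * (N : ℝ) ^ (-(m - (n - 1))) := by
    have hN' : (0 : ℝ) < N := by exact_mod_cast hN
    have h := hC ((N : ℝ) • L) (N * M) (by
      intro x hx i
      rw [← SetLike.mem_coe, ConvexBody.coe_smul] at hx
      obtain ⟨y, hy, rfl⟩ := hx
      have := hM y hy i
      simp only [map_smul, smul_eq_mul, Nat.cast_mul]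
      exact ⟨mul_pos hN' this.1, mul_lt_mul_of_pos_left this.2 hN'⟩)
    rw [hhom N hN'.le, abs_mul, abs_of_pos (Real.rpow_pos_of_pos hN' m)] at h
    have hpow : ((N : ℝ) ^ (n - 1) : ℝ) = (N : ℝ) ^ ((n : ℝ) - 1) := by
      rw [← Real.rpow_natCast, Nat.cast_pred hn]
    rw [neg_sub, Real.rpow_sub hN', ← hpow, ← mul_div_assoc,
      le_div_iff₀ (Real.rpow_pos_of_pos hN' m), mul_comm]
    refine h.trans_eq ?_
    rw [hD]
    push_cast
    ring
  have hlim : Filter.Tendsto (fun N : ℕ => D * (N : ℝ) ^ (-(m - (n - 1)))) Filter.atTop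
      (nhds 0) := by
    simpa using ((tendsto_rpow_neg_atTop (sub_pos.2 hm)).comp
      tendsto_natCast_atTop_atTop).const_mul D
  exact abs_nonpos_iff.1 (ge_of_tendsto hlim (Filter.eventually_atTop.2 ⟨1, hbound⟩))
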